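/- Let $G=(V,E)$ be a finite simple undirected graph with $n=|V|\ge 2$ vertices (not necessarily connected). For $\emptyset\ne S\subseteq V$ let $\nu(E(S,S^c))$ be the maximum number of edges in a matching consisting of edges of $G$ between $S$ and $S^c=V\setminus S$, and define the matching conductance $$\Upsilon(S)=\frac{\nu(E(S,S^c))}{|S|},\qquad \Upsilon^\star(G)=\min_{S\subseteq V:\ 0<|S|\le |V|/2}\Upsilon(S).$$ Let $$\lambda_1(G)=\inf\ \frac{\sum_{u\in V}g(u)}{\sum_{u\in V}f(u)^2}$$ over all $f\colon V\to\mathbb R$, $f\not\equiv 0$, and $g\colon V\to\mathbb R_{\ge 0}$ with $\sum_{u\in V}f(u)=0$ and $g(u)+g(v)\ge (f(u)-f(v))^2$ for every $\{u,v\}\in E$. Let $\lambda^\star(G)$ be the optimal spectral gap, i.e. the supremum of $1-\lambda_P$ over all transition matrices $P$ on $V$ that are symmetric (equivalently, reversible with respect to the uniform distribution on $V$), lazy ($P(v,v)\ge\frac12$ for all $v$) and supported on $G$ ($P(u,v)>0$ only if $u=v$ or $\{u,v\}\in E$), where $\lambda_P$ is the second largest eigenvalue of $P$, counted with multiplicity.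 Then there are universal constants $c,C>0$ (independent of $G$ and $n$) such that $$c\,\Upsilon^\star(G)^2\le\lambda_1(G)\le C\,\Upsilon^\star(G) \qquad\text{and}\qquad c\,\frac{\Upsilon^\star(G)^2}{\log n}\le\lambda^\star(G)\le C\,\Upsilon^\star(G).$$ -/

import Mathlib

universe u

/-- The matching number `ν(E(H))` of a finite unweighted graph `H`: the largest number of edges in
a matching, i.e. in a set of edges no two of which share an endpoint. -/
noncomputable def matchingNumber {V : Type u} (H : SimpleGraph V) : ℕ :=
  sSup {k : ℕ | ∃ M : H.Subgraph, M.IsMatching ∧ M.edgeSet.ncard = k}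

/-- The matching conductance `Υ(S) = ν(E(S, Sᶜ)) / |S|` of a vertex set `S`;
`G.between S Sᶜ` is the graph whose edges are the edges of `G` between `S` and `Sᶜ`. -/
noncomputable def setMatchingConductance {V : Type u} (G : SimpleGraph V) (S : Finset V) : ℝ :=
  (matchingNumber (G.between (S : Set V) (S : Set V)ᶜ) : ℝ) / (S.card : ℝ)

/-- The matching conductance of `G`: the minimum of `Υ(S)` over the vertex sets `S` with
`0 < |S| ≤ |V| / 2`. -/
noncomputable def matchingConductance {V : Type u} [Fintype V] (G : SimpleGraph V) : ℝ :=
  sInf {r : ℝ | ∃ S : Finset V, 0 < S.card ∧ (S.card : ℝ) ≤ (Fintype.card V : ℝ) / 2 ∧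
    r = setMatchingConductance G S}

/-- The one-dimensional embedding parameter `λ₁(G)`: the minimum of `∑ g / ∑ f²` over `f : V → ℝ`
with mean zero and `g : V → ℝ≥0` with `g u + g v ≥ (f u - f v)²` on every edge. The ratio only
makes sense for `f ≠ 0`. -/
noncomputable def oneDimGap {V : Type u} [Fintype V] (G : SimpleGraph V) : ℝ :=
  sInf {r : ℝ | ∃ f g : V → ℝ, f ≠ 0 ∧ (∀ v, 0 ≤ g v) ∧ ∑ v, f v = 0 ∧
    (∀ v w, G.Adj v w → (f v - f w) ^ 2 ≤ g v + g w) ∧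
    r = (∑ v, g v) / ∑ v, f v ^ 2}

/-- `P` is the transition matrix of a lazy Markov chain on `G` that is reversible with respect
to `π`. -/
structure IsLazyReversibleOn {V : Type u} [Fintype V] (G : SimpleGraph V) (π : V → ℝ)
    (P : Matrix V V ℝ) : Prop where
  nonneg : ∀ v w, 0 ≤ P v w
  row_sum : ∀ v, ∑ w, P v w = 1
  on_graph : ∀ v w, 0 < P v w → G.Adj v w ∨ v = w
  lazy : ∀ v, 1 / 2 ≤ P v v
  reversible : ∀ v w, π v * P v w = π w * P w v

/-- The spectral gap `1 - λ_P` of a reversible transition matrix, where `λ_P` is the largest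
eigenvalue after one copy of the trivial eigenvalue `1` has been removed from the list of
eigenvalues, which are counted with multiplicity. -/
noncomputable def spectralGap {V : Type u} [Fintype V] [DecidableEq V] (P : Matrix V V ℝ) : ℝ :=
  1 - sSup {μ : ℝ | μ ∈ P.charpoly.roots.erase 1}

/-- The optimal spectral gap for the equilibrium distribution `π`: the maximum spectral gap of a
lazy `π`-reversible Markov chain on `G`. -/
noncomputable def optimalSpectralGap {V : Type u} [Fintype V] [DecidableEq V]
    (G : SimpleGraph V) (π : V → ℝ) : ℝ :=
  sSup {γ : ℝ | ∃ P : Matrix V V ℝ, IsLazyReversibleOn G π P ∧ γ = spectralGap P}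

/-- The uniform probability distribution on `V`. -/
noncomputable def uniformDist (V : Type u) [Fintype V] : V → ℝ :=
  fun _ => 1 / (Fintype.card V : ℝ)

/-! Write Υ, λ₁, λ* for the three parameters. The theorem combines λ₁ ≤ 4Υ, Υ² ≤ 72 λ₁, λ* ≤ λ₁/2
and λ₁ ≤ 384 (log n) λ*.

Up to a factor 2 the matching number of a cut is the least size of a vertex cover of it, and the
function `g` in λ₁ is a weighted cover of the squared edge lengths. So the centred indicator of `S`
together with the indicator of a cover gives λ₁ ≤ 4Υ. Conversely, a Cheeger argument cuts `f` at
every level on either side of a median: the vertices whose value lies within about √(2g) of the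
level cover the cut (`matchingConductance_mul_sum_sq_le`).

Summing the edge constraints against a lazy symmetric `P` bounds its Dirichlet form by half of `∑
g`, hence λ* ≤ λ₁/2. For the reverse bound, each matching defines a lazy chain, and minimax over
mixtures of these chains yields a vector embedding with small energy along every matching at once
(`exists_vector_embedding`). A greedy matching controls all edges (`exists_dominating_matching`), so
this is a vector-valued solution of the λ₁ problem. Random signs project it to the line; only this
projection costs log n (`exists_signs_projection`). -/

/-! ### Matchings and vertex covers -/

lemma matchingNumber_le_card_of_cover {V : Type u} [Finite V] (H : SimpleGraph V) (C : Finset V)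
    (hC : ∀ v w, H.Adj v w → v ∈ C ∨ w ∈ C) : matchingNumber H ≤ C.card := by
  apply csSup_le'
  rintro k ⟨M, hM, rfl⟩
  have key : ∀ e : Sym2 V, ∃ v, e ∈ M.edgeSet → v ∈ C ∧ v ∈ e := by
    intro e
    induction e with | _ a b =>
    by_cases h : M.Adj a b
    · rcases hC a b h.adj_sub with h' | h'
      · exact ⟨a, fun _ => ⟨h', by simp⟩⟩
      · exact ⟨b, fun _ => ⟨h', by simp⟩⟩
    · exact ⟨a, fun h' => (h h').elim⟩
  choose p hp using key
  rw [← Set.ncard_coe_finset C]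
  refine Set.ncard_le_ncard_of_injOn p (fun e he => (hp e he).1) ?_ (Set.toFinite _)
  intro e he e' he' hee
  obtain ⟨a, ha⟩ := Sym2.mem_iff_exists.1 (hp e he).2
  obtain ⟨b, hb⟩ := Sym2.mem_iff_exists.1 (hp e' he').2
  rw [hee] at ha
  have h1 : M.Adj (p e') a := by rw [ha] at he; exact he
  have h2 : M.Adj (p e') b := by rw [hb] at he'; exact he'
  exact ha.trans ((congrArg (fun x => s(p e', x)) (hM.eq_of_adj_left h1 h2)).trans hb.symm)

/-- The endpoints of a maximum matching form a cover: an edge missing all of them could be added to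
the matching. -/
lemma exists_cover_card_le {V : Type u} [Finite V] (H : SimpleGraph V) :
    ∃ C : Finset V, (∀ v w, H.Adj v w → v ∈ C ∨ w ∈ C) ∧ C.card ≤ 2 * matchingNumber H := by
  classical
  have := Fintype.ofFinite V
  set K := {k : ℕ | ∃ M : H.Subgraph, M.IsMatching ∧ M.edgeSet.ncard = k} with hK
  have hbdd : BddAbove K := by
    refine ⟨(Set.univ : Set (Sym2 V)).ncard, ?_⟩
    rintro k ⟨M, -, rfl⟩
    exact Set.ncard_le_ncard (Set.subset_univ _) (Set.toFinite _)
  have hne : K.Nonempty := ⟨_, ⊥, fun v hv => hv.elim, rfl⟩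
  obtain ⟨M, hM, hcard⟩ := Nat.sSup_mem hne hbdd
  refine ⟨M.edgeSet.toFinset.biUnion fun e => e.toFinset, ?_, ?_⟩
  · have hmem : ∀ v, v ∈ M.support →
        v ∈ M.edgeSet.toFinset.biUnion fun e : Sym2 V => e.toFinset := by
      rintro v ⟨w, hw⟩
      simp only [Finset.mem_biUnion, Set.mem_toFinset, Sym2.mem_toFinset]
      exact ⟨s(v, w), hw, by simp⟩
    intro v w hvw
    by_contra! hcon
    have hv : v ∉ M.support := fun h => hcon.1 (hmem v h)
    have hw : w ∉ M.support := fun h => hcon.2 (hmem w h)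
    have hdisj : Disjoint M.support (H.subgraphOfAdj hvw).support := by
      rw [SimpleGraph.support_subgraphOfAdj, Set.disjoint_right]
      rintro x (rfl | rfl) <;> assumption
    have hmatch := hM.sup (SimpleGraph.Subgraph.IsMatching.subgraphOfAdj hvw) hdisj
    have hle := le_csSup hbdd (show (M ⊔ H.subgraphOfAdj hvw).edgeSet.ncard ∈ K from
      ⟨_, hmatch, rfl⟩)
    rw [← hcard, SimpleGraph.Subgraph.edgeSet_sup, SimpleGraph.edgeSet_subgraphOfAdj,
      Set.union_singleton, Set.ncard_insert_of_notMem (a := s(v, w)) (fun h => hv ⟨w, h⟩) (Set.toFinite _)] at hle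
    omega
  · refine Finset.card_biUnion_le.trans ?_
    have : ∀ e ∈ M.edgeSet.toFinset, (Sym2.toFinset e).card ≤ 2 := by
      intro e _
      rw [Sym2.card_toFinset]; split_ifs <;> omega
    refine (Finset.sum_le_card_nsmul _ _ 2 this).trans ?_
    rw [show matchingNumber H = sSup K from rfl, ← hcard, Set.ncard_eq_toFinset_card',
      smul_eq_mul, mul_comm]

lemma setMatchingConductance_nonneg {V : Type u} (G : SimpleGraph V) (S : Finset V) :
    0 ≤ setMatchingConductance G S := by
  unfold setMatchingConductance; positivity

lemma setMatchingConductance_le_one {V : Type u} [Finite V] (G : SimpleGraph V) (S : Finset V) :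
    setMatchingConductance G S ≤ 1 := by
  refine div_le_one_of_le₀ ?_ (by positivity)
  exact_mod_cast matchingNumber_le_card_of_cover _ S fun v w h => by
    rcases h.2 with h | h
    · exact Or.inl (by simpa using h.1)
    · exact Or.inr (by simpa using h.2)

/-! ### Matching conductance and the one-dimensional embedding: the Cheeger inequality -/

section Conductance

variable {V : Type u} [Fintype V]

lemma matchingConductance_nonneg (G : SimpleGraph V) : 0 ≤ matchingConductance G := by
  apply Real.sInf_nonneg
  rintro r ⟨S, -, -, rfl⟩
  exact setMatchingConductance_nonneg G S

lemma matchingConductance_le (G : SimpleGraph V) (S : Finset V) (h0 : 0 < S.card)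
    (h1 : (S.card : ℝ) ≤ (Fintype.card V : ℝ) / 2) :
    matchingConductance G ≤ setMatchingConductance G S := by
  refine csInf_le ⟨0, ?_⟩ ⟨S, h0, h1, rfl⟩
  rintro r ⟨S, -, -, rfl⟩
  exact setMatchingConductance_nonneg G S

lemma exists_half_set (hV : 2 ≤ Fintype.card V) :
    ∃ S : Finset V, 0 < S.card ∧ (S.card : ℝ) ≤ (Fintype.card V : ℝ) / 2 := by
  have : Nonempty V := Fintype.card_pos_iff.1 (by omega)
  have h : (2 : ℝ) ≤ Fintype.card V := by exact_mod_cast hV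
  exact ⟨{Classical.arbitrary V}, by simp, by simp; linarith⟩

lemma matchingConductance_le_one (G : SimpleGraph V) (hV : 2 ≤ Fintype.card V) :
    matchingConductance G ≤ 1 := by
  obtain ⟨S, h0, h1⟩ := exists_half_set hV
  exact (matchingConductance_le G S h0 h1).trans (setMatchingConductance_le_one G S)

lemma oneDimGap_le (G : SimpleGraph V) {f g : V → ℝ} (hf : f ≠ 0) (hg : ∀ v, 0 ≤ g v)
    (hs : ∑ v, f v = 0) (he : ∀ v w, G.Adj v w → (f v - f w) ^ 2 ≤ g v + g w) :
    oneDimGap G ≤ (∑ v, g v) / ∑ v, f v ^ 2 := by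
  refine csInf_le ⟨0, ?_⟩ ⟨f, g, hf, hg, hs, he, rfl⟩
  rintro r ⟨f, g, -, hg, -, -, rfl⟩
  exact div_nonneg (Finset.sum_nonneg fun v _ => hg v) (Finset.sum_nonneg fun v _ => sq_nonneg _)

lemma sum_sq_pos {f : V → ℝ} (hf : f ≠ 0) : 0 < ∑ v, f v ^ 2 := by
  obtain ⟨v, hv⟩ := Function.ne_iff.1 hf
  exact Finset.sum_pos' (fun v _ => sq_nonneg _) ⟨v, Finset.mem_univ v, by
    have : f v ≠ 0 := hv
    positivity⟩

lemma oneDimGap_le_four_mul_setMatchingConductance (G : SimpleGraph V) (S : Finset V)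
    (h0 : 0 < S.card) (h1 : (S.card : ℝ) ≤ (Fintype.card V : ℝ) / 2) :
    oneDimGap G ≤ 4 * setMatchingConductance G S := by
  classical
  obtain ⟨C, hC, hcard⟩ := exists_cover_card_le (G.between (S : Set V) (S : Set V)ᶜ)
  have hS : (0 : ℝ) < S.card := by exact_mod_cast h0
  have hn : (0 : ℝ) < Fintype.card V := by linarith
  set p : ℝ := S.card / Fintype.card V with hp
  have hp2 : p ≤ 1 / 2 := by rw [hp, div_le_iff₀ hn]; linarith
  have hpn : p * Fintype.card V = S.card := by rw [hp]; field_simp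
  set f : V → ℝ := fun v => (if v ∈ S then 1 else 0) - p with hf
  set g : V → ℝ := fun v => if v ∈ C then 1 else 0 with hg
  have hsum : ∑ v, f v = 0 := by
    simp only [hf, Finset.sum_sub_distrib, Finset.sum_const, nsmul_eq_mul, Finset.card_univ]
    rw [mul_comm, hpn]; simp
  have hsq : ∑ v, f v ^ 2 = S.card * (1 - p) := by
    have : ∀ v, f v ^ 2 = (1 - 2 * p) * (if v ∈ S then 1 else 0) + p ^ 2 := by
      intro v; simp only [hf]; split_ifs <;> ring
    simp only [this, Finset.sum_add_distrib, ← Finset.mul_sum, Finset.sum_const, nsmul_eq_mul,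
      Finset.card_univ]
    rw [show (Fintype.card V : ℝ) * p ^ 2 = p * Fintype.card V * p by ring, hpn]
    simp; ring
  -- This 1/2 and the factor 2 lost in the cover make up the constant 4.
  have hsq2 : (S.card : ℝ) / 2 ≤ ∑ v, f v ^ 2 := by rw [hsq]; nlinarith
  have hf0 : f ≠ 0 := by
    intro h
    rw [h] at hsq2
    simp at hsq2
    linarith
  refine (oneDimGap_le G hf0 (g := g) (fun v => by simp only [hg]; split_ifs <;> norm_num)
    hsum ?_).trans ?_
  · intro v w hvw
    have hcase : (v ∈ S ↔ w ∈ S) ∨ (v ∈ C ∨ w ∈ C) := by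
      by_cases hv : v ∈ S <;> by_cases hw : w ∈ S
      · simp [hv, hw]
      · exact Or.inr (hC v w ⟨hvw, by simp [hv, hw]⟩)
      · exact Or.inr (hC v w ⟨hvw, by simp [hv, hw]⟩)
      · simp [hv, hw]
    simp only [hf, hg, sub_sub_sub_cancel_right]
    by_cases hv : v ∈ S <;> by_cases hw : w ∈ S <;> by_cases hv' : v ∈ C <;>
      by_cases hw' : w ∈ C <;> simp [hv, hw, hv', hw'] at hcase ⊢
  · have hgs : ∑ v, g v = C.card := by simp [hg]
    have hcard' : (C.card : ℝ) ≤ 2 * matchingNumber (G.between (S : Set V) (S : Set V)ᶜ) := by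
      exact_mod_cast hcard
    rw [hgs, setMatchingConductance, div_le_iff₀ (by linarith)]
    calc (C.card : ℝ) ≤ 4 * (matchingNumber (G.between (S : Set V) (S : Set V)ᶜ) / S.card)
          * (S.card / 2) := by field_simp; linarith
      _ ≤ _ := by gcongr

lemma oneDimGap_le_four_mul_matchingConductance (G : SimpleGraph V) (hV : 2 ≤ Fintype.card V) :
    oneDimGap G ≤ 4 * matchingConductance G := by
  have : oneDimGap G / 4 ≤ matchingConductance G := by
    obtain ⟨S, h0, h1⟩ := exists_half_set hV
    refine le_csInf ⟨_, S, h0, h1, rfl⟩ ?_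
    rintro r ⟨S, h0, h1, rfl⟩
    linarith [oneDimGap_le_four_mul_setMatchingConductance G S h0 h1]
  linarith

/-- The threshold form of the Cheeger argument, integrated over all thresholds. -/
lemma matchingConductance_mul_sum_sq_le (G : SimpleGraph V) {f h : V → ℝ} (hf : ∀ v, 0 ≤ f v)
    (hh : ∀ v, 0 ≤ h v) (hsupp : 2 * (Finset.univ.filter fun v => 0 < f v).card ≤ Fintype.card V)
    (he : ∀ v w, G.Adj v w → |f v - f w| ≤ max (h v) (h w)) :
    matchingConductance G * ∑ v, f v ^ 2 ≤ ∑ v, (4 * (f v * h v) + h v ^ 2) := by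
  classical
  set a : V → ℝ := fun v => max (f v - h v) 0 ^ 2 with ha
  set b : V → ℝ := fun v => (f v + h v) ^ 2 with hb
  have hab : ∀ v, a v ≤ b v := fun v => by
    simp only [ha, hb]
    exact pow_le_pow_left₀ (le_max_right _ _)
      (max_le (by linarith [hh v]) (by linarith [hf v, hh v])) 2
  -- At level `t` this says Υ · |S| ≤ |C|, where `S` is the superlevel set of `f ^ 2` and `C` covers
  -- its boundary edges.
  have hpoint : ∀ t : ℝ, matchingConductance G * ∑ v, (Set.Ico 0 (f v ^ 2)).indicator 1 t ≤
      ∑ v, (Set.Ico (a v) (b v)).indicator (1 : ℝ → ℝ) t := by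
    intro t
    have hnn : 0 ≤ ∑ v, (Set.Ico (a v) (b v)).indicator (1 : ℝ → ℝ) t :=
      Finset.sum_nonneg fun v _ => Set.indicator_nonneg (fun _ _ => zero_le_one) _
    rcases lt_or_ge t 0 with ht | ht
    · have : ∀ v, (Set.Ico 0 (f v ^ 2)).indicator (1 : ℝ → ℝ) t = 0 := fun v =>
        Set.indicator_of_notMem (fun h => absurd h.1 (not_le.2 ht)) _
      simpa [this] using hnn
    set S : Finset V := Finset.univ.filter fun v => t < f v ^ 2 with hS
    have hsumS : ∑ v, (Set.Ico 0 (f v ^ 2)).indicator (1 : ℝ → ℝ) t = S.card := by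
      simp [Set.indicator_apply, ht, hS]
    rw [hsumS]
    rcases Nat.eq_zero_or_pos S.card with h0 | h0
    · simpa [h0] using hnn
    set C : Finset V := Finset.univ.filter fun v => t ∈ Set.Ico (a v) (b v) with hCdef
    have hsumC : ∑ v, (Set.Ico (a v) (b v)).indicator (1 : ℝ → ℝ) t = C.card := by
      simp [Set.indicator_apply, hCdef]
    rw [hsumC]
    have hhalf : (S.card : ℝ) ≤ (Fintype.card V : ℝ) / 2 := by
      have : S.card ≤ (Finset.univ.filter fun v => 0 < f v).card := by
        refine Finset.card_le_card fun v hv => ?_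
        simp only [hS, Finset.mem_filter, Finset.mem_univ, true_and] at hv ⊢
        exact lt_of_le_of_ne (hf v) fun h => by rw [← h] at hv; norm_num at hv; linarith
      have : 2 * S.card ≤ Fintype.card V := by omega
      have : (2 : ℝ) * S.card ≤ Fintype.card V := by exact_mod_cast this
      linarith
    have hle := matchingConductance_le G S h0 hhalf
    rw [setMatchingConductance, le_div_iff₀ (by exact_mod_cast h0)] at hle
    refine hle.trans ?_
    -- The endpoint with the larger `h` can reach the other's value within distance `h`, so its
    -- interval contains `t`.
    have hedge : ∀ u v, G.Adj u v → t < f u ^ 2 → f v ^ 2 ≤ t → u ∈ C ∨ v ∈ C := by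
      intro u v huv hu hv
      have hlt : f v < f u := lt_of_pow_lt_pow_left₀ 2 (hf u) (hv.trans_lt hu)
      have := he u v huv
      rw [abs_of_pos (by linarith)] at this
      simp only [hCdef, Finset.mem_filter, Finset.mem_univ, true_and, Set.mem_Ico, ha, hb]
      rcases le_max_iff.1 this with h' | h'
      · left
        exact ⟨(pow_le_pow_left₀ (le_max_right _ _) (max_le (by linarith) (hf v)) 2).trans hv,
          hu.trans_le (pow_le_pow_left₀ (hf u) (by linarith [hh u]) 2)⟩
      · right
        exact ⟨(pow_le_pow_left₀ (le_max_right _ _)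
          (max_le (by linarith [hh v]) (hf v)) 2).trans hv,
          hu.trans_le (pow_le_pow_left₀ (hf u) (by linarith) 2)⟩
    exact_mod_cast matchingNumber_le_card_of_cover _ C fun u v huv => by
      rcases huv.2 with ⟨h1, h2⟩ | ⟨h1, h2⟩ <;>
        simp [hS] at h1 h2
      · exact hedge u v huv.1 h1 h2
      · exact (hedge v u huv.1.symm h2 h1).symm
  have hint : ∀ x y : ℝ,
      MeasureTheory.Integrable ((Set.Ico x y).indicator (1 : ℝ → ℝ)) MeasureTheory.volume := by
    intro x y
    exact (MeasureTheory.integrable_indicator_iff measurableSet_Ico).2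
      (MeasureTheory.integrableOn_const (by simp))
  have hI : ∀ x y : ℝ, x ≤ y → ∫ t, (Set.Ico x y).indicator (1 : ℝ → ℝ) t = y - x := by
    intro x y hxy
    rw [MeasureTheory.integral_indicator_one measurableSet_Ico]
    simp [hxy]
  have hmono := MeasureTheory.integral_mono
    ((MeasureTheory.integrable_finsetSum Finset.univ fun v _ => hint 0 (f v ^ 2)).const_mul
      (matchingConductance G))
    (MeasureTheory.integrable_finsetSum Finset.univ fun v _ => hint (a v) (b v)) hpoint
  rw [MeasureTheory.integral_const_mul,
    MeasureTheory.integral_finsetSum _ fun v _ => hint _ _,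
    MeasureTheory.integral_finsetSum _ fun v _ => hint _ _] at hmono
  simp only [hI _ _ (sq_nonneg _), hI _ _ (hab _), sub_zero] at hmono
  -- The interval length is `4 * f v * h v` when `h v ≤ f v`; otherwise `f v ^ 2 ≤ f v * h v` leaves
  -- the extra `h v ^ 2`.
  refine hmono.trans (Finset.sum_le_sum fun v _ => ?_)
  simp only [ha, hb]
  rcases le_total (f v - h v) 0 with h' | h'
  · rw [max_eq_right h']; nlinarith [hf v, hh v]
  · rw [max_eq_left h']; nlinarith [hf v, hh v]

lemma matchingConductance_sq_mul_sum_sq_le (G : SimpleGraph V) (hV : 2 ≤ Fintype.card V)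
    {f g : V → ℝ} (hf : ∀ v, 0 ≤ f v) (hg : ∀ v, 0 ≤ g v)
    (hsupp : 2 * (Finset.univ.filter fun v => 0 < f v).card ≤ Fintype.card V)
    (he : ∀ v w, G.Adj v w → (f v - f w) ^ 2 ≤ g v + g w) :
    matchingConductance G ^ 2 * ∑ v, f v ^ 2 ≤ 36 * ∑ v, g v := by
  have h1 := matchingConductance_le_one G hV
  rcases (matchingConductance_nonneg G).eq_or_lt with h0 | h0
  · rw [← h0]
    have := Finset.sum_nonneg fun v (_ : v ∈ Finset.univ) => hg v
    norm_num; linarith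
  set κ := matchingConductance G
  -- This `h` is admissible because `g v + g w` is at most twice the maximum.
  have hkey := matchingConductance_mul_sum_sq_le G hf (h := fun v => √(2 * g v))
    (fun v => Real.sqrt_nonneg _) hsupp ?_
  -- AM-GM with weight κ: half of the left side of `hkey` absorbs the `f` term, and κ ≤ 1 absorbs `h
  -- ^ 2` into the `g` term.
  · have hle : ∀ v, 4 * (f v * √(2 * g v)) + √(2 * g v) ^ 2 ≤
        κ / 2 * f v ^ 2 + 18 / κ * g v := by
      intro v
      have hs : √(2 * g v) ^ 2 = 2 * g v := Real.sq_sqrt (by linarith [hg v])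
      set s := √(2 * g v)
      have hg' : g v = s ^ 2 / 2 := by linarith
      rw [hg', ← sub_nonneg]
      have : κ / 2 * f v ^ 2 + 18 / κ * (s ^ 2 / 2) - (4 * (f v * s) + s ^ 2) =
          ((κ * f v - 4 * s) ^ 2 + 2 * (1 - κ) * s ^ 2) / (2 * κ) := by field_simp; ring
      rw [this]
      have : 0 ≤ 1 - κ := by linarith
      positivity
    have h2 := hkey.trans (Finset.sum_le_sum fun v _ => hle v)
    rw [Finset.sum_add_distrib, ← Finset.mul_sum, ← Finset.mul_sum] at h2
    have h3 : κ / 2 * ∑ v, f v ^ 2 ≤ 18 / κ * ∑ v, g v := by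
      have : matchingConductance G = κ := rfl
      rw [this] at h2
      linarith
    have h4 := mul_le_mul_of_nonneg_left h3 (show 0 ≤ 2 * κ by positivity)
    calc κ ^ 2 * ∑ v, f v ^ 2 = 2 * κ * (κ / 2 * ∑ v, f v ^ 2) := by ring
      _ ≤ _ := h4
      _ = _ := by field_simp; ring
  · intro v w hvw
    have := he v w hvw
    rcases le_total (g v) (g w) with h | h
    · exact (Real.abs_le_sqrt (by linarith)).trans (le_max_right _ _)
    · exact (Real.abs_le_sqrt (by linarith)).trans (le_max_left _ _)

/-- Take the least value with at most half of the vertices strictly above it. If more than half were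
strictly below, the next smaller value would also qualify. -/
lemma exists_median [Nonempty V] (f : V → ℝ) :
    ∃ m : ℝ, 2 * (Finset.univ.filter fun v => m < f v).card ≤ Fintype.card V ∧
      2 * (Finset.univ.filter fun v => f v < m).card ≤ Fintype.card V := by
  classical
  set A : Finset V := Finset.univ.filter fun u =>
    2 * (Finset.univ.filter fun v => f u < f v).card ≤ Fintype.card V with hA
  have hAne : A.Nonempty := by
    obtain ⟨u, hu⟩ := Finite.exists_max f
    refine ⟨u, ?_⟩
    simp only [hA, Finset.mem_filter, Finset.mem_univ, true_and]
    rw [Finset.filter_false_of_mem fun v _ => not_lt.2 (hu v)]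
    simp
  obtain ⟨u, huA, hu⟩ := A.exists_min_image f hAne
  refine ⟨f u, (Finset.mem_filter.1 huA).2, ?_⟩
  by_contra! hcon
  have hB : (Finset.univ.filter fun v => f v < f u).Nonempty := by
    rw [← Finset.card_pos]; omega
  obtain ⟨w, hwB, hw⟩ := Finset.exists_max_image _ f hB
  have hwu : f w < f u := (Finset.mem_filter.1 hwB).2
  have hwA : w ∉ A := fun h => absurd (hu w h) (not_le.2 hwu)
  apply hwA
  simp only [hA, Finset.mem_filter, Finset.mem_univ, true_and]
  have hsub : (Finset.univ.filter fun v => f w < f v) ⊆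
      Finset.univ.filter fun v => ¬ f v < f u := by
    intro v hv
    simp only [Finset.mem_filter, Finset.mem_univ, true_and] at hv ⊢
    intro h
    exact absurd (hw v (by simp [h])) (not_le.2 hv)
  have h1 := Finset.card_le_card hsub
  have h2 := Finset.card_filter_add_card_filter_not (s := (Finset.univ : Finset V))
    (fun v => f v < f u)
  rw [Finset.card_univ] at h2
  omega

lemma sq_max_sub_max_le (a b : ℝ) : (max a 0 - max b 0) ^ 2 ≤ (a - b) ^ 2 :=
  sq_le_sq.2 (abs_max_sub_max_le_abs a b 0)

/-- Feasibility is needed for lower bounds on λ₁, since the real infimum of the empty set is 0 by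
convention. -/
lemma exists_oneDim_pair (G : SimpleGraph V) (hV : 2 ≤ Fintype.card V) :
    ∃ f g : V → ℝ, f ≠ 0 ∧ (∀ v, 0 ≤ g v) ∧ ∑ v, f v = 0 ∧
      (∀ v w, G.Adj v w → (f v - f w) ^ 2 ≤ g v + g w) := by
  classical
  obtain ⟨a, b, hab⟩ := Fintype.one_lt_card_iff.1 (show 1 < Fintype.card V by omega)
  set f : V → ℝ := Pi.single a 1 - Pi.single b 1 with hf
  refine ⟨f, fun v => 2 * f v ^ 2, ?_, fun v => by positivity, ?_, fun v w _ => ?_⟩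
  · intro h
    have := congrFun h a
    simp [hf, hab] at this
  · simp [hf]
  · nlinarith [sq_nonneg (f v + f w)]

lemma matchingConductance_sq_le_mul_oneDimGap (G : SimpleGraph V) (hV : 2 ≤ Fintype.card V) :
    matchingConductance G ^ 2 ≤ 72 * oneDimGap G := by
  have : Nonempty V := Fintype.card_pos_iff.1 (by omega)
  have : matchingConductance G ^ 2 / 72 ≤ oneDimGap G := by
    obtain ⟨f₀, g₀, hf₀, hg₀, hs₀, he₀⟩ := exists_oneDim_pair G hV
    refine le_csInf ⟨_, f₀, g₀, hf₀, hg₀, hs₀, he₀, rfl⟩ ?_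
    rintro r ⟨f, g, hf, hg, hs, he, rfl⟩
    obtain ⟨m, hm1, hm2⟩ := exists_median f
    have hpos := matchingConductance_sq_mul_sum_sq_le G hV (f := fun v => max (f v - m) 0) (g := g)
      (fun v => le_max_right _ _) hg (by simpa using hm1) fun v w hvw =>
        (sq_max_sub_max_le _ _).trans (by simpa using he v w hvw)
    have hneg := matchingConductance_sq_mul_sum_sq_le G hV (f := fun v => max (m - f v) 0) (g := g)
      (fun v => le_max_right _ _) hg (by simpa using hm2) fun v w hvw =>
        (sq_max_sub_max_le _ _).trans (by
          have := he v w hvw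
          calc (m - f v - (m - f w)) ^ 2 = (f v - f w) ^ 2 := by ring
            _ ≤ _ := this)
    -- Shifting by the median only increases the sum of squares, as `f` has mean zero.
    have hsplit : ∑ v, f v ^ 2 ≤
        ∑ v, max (f v - m) 0 ^ 2 + ∑ v, max (m - f v) 0 ^ 2 := by
      have h1 : ∀ v, max (f v - m) 0 ^ 2 + max (m - f v) 0 ^ 2 =
          f v ^ 2 - 2 * m * f v + m ^ 2 := by
        intro v
        rcases le_total (f v) m with h | h
        · rw [max_eq_right (by linarith), max_eq_left (by linarith)]; ring
        · rw [max_eq_left (by linarith), max_eq_right (by linarith)]; ring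
      rw [← Finset.sum_add_distrib]
      simp only [h1, Finset.sum_add_distrib, Finset.sum_sub_distrib, ← Finset.mul_sum, hs]
      have : 0 ≤ ∑ _v : V, m ^ 2 := Finset.sum_nonneg fun _ _ => sq_nonneg m
      linarith
    rw [le_div_iff₀ (sum_sq_pos hf)]
    have := mul_le_mul_of_nonneg_left hsplit (sq_nonneg (matchingConductance G))
    linarith
  linarith

end Conductance

/-! ### The spectral gap, its variational formula and the bound by λ₁ -/

section Spectral

variable {V : Type u} [Fintype V]

/-- The Dirichlet form of a symmetric transition matrix. -/
noncomputable def dirichletForm (P : Matrix V V ℝ) (f : V → ℝ) : ℝ :=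
  1 / 2 * ∑ u, ∑ v, P u v * (f u - f v) ^ 2

open Matrix

lemma dirichletForm_nonneg {P : Matrix V V ℝ} (hP : ∀ u v, 0 ≤ P u v) (f : V → ℝ) :
    0 ≤ dirichletForm P f := by
  unfold dirichletForm
  have : 0 ≤ ∑ u, ∑ v, P u v * (f u - f v) ^ 2 :=
    Finset.sum_nonneg fun u _ => Finset.sum_nonneg fun v _ => mul_nonneg (hP u v) (sq_nonneg _)
  linarith

lemma dirichletForm_eq {P : Matrix V V ℝ} (hsymm : ∀ u v, P u v = P v u)
    (hrow : ∀ u, ∑ v, P u v = 1) (f : V → ℝ) :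
    dirichletForm P f = f ⬝ᵥ f - f ⬝ᵥ (P *ᵥ f) := by
  have h1 : ∑ u, ∑ v, P u v * f u ^ 2 = f ⬝ᵥ f := by
    simp only [← Finset.sum_mul, hrow, dotProduct, one_mul, sq]
  have h2 : ∑ u, ∑ v, P u v * f v ^ 2 = f ⬝ᵥ f := by
    rw [Finset.sum_comm, ← h1]
    exact Finset.sum_congr rfl fun u _ => Finset.sum_congr rfl fun v _ => by rw [hsymm]
  have h3 : ∑ u, ∑ v, P u v * (f u * f v) = f ⬝ᵥ (P *ᵥ f) := by
    simp only [dotProduct, mulVec, Finset.mul_sum]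
    exact Finset.sum_congr rfl fun u _ => Finset.sum_congr rfl fun v _ => by ring
  have h4 : ∀ u v, P u v * (f u - f v) ^ 2 =
      P u v * f u ^ 2 + P u v * f v ^ 2 - 2 * (P u v * (f u * f v)) := fun u v => by ring
  unfold dirichletForm
  simp only [h4, Finset.sum_add_distrib, Finset.sum_sub_distrib, ← Finset.mul_sum, h1, h2, h3]
  ring

variable [DecidableEq V]

lemma exists_orthonormal_eigenvectors {P : Matrix V V ℝ} (hsymm : ∀ u v, P u v = P v u) :
    ∃ (μ : V → ℝ) (b : V → V → ℝ), P.charpoly.roots = Finset.univ.val.map μ ∧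
      (∀ i, P *ᵥ b i = μ i • b i) ∧ (∀ i j, b i ⬝ᵥ b j = if i = j then 1 else 0) ∧
      (∀ f g : V → ℝ, f ⬝ᵥ g = ∑ i, (b i ⬝ᵥ f) * (b i ⬝ᵥ g)) := by
  have hP : P.IsHermitian := Matrix.IsHermitian.ext fun u v => by simp [hsymm u v]
  refine ⟨hP.eigenvalues, fun i => (hP.eigenvectorBasis i).ofLp, ?_,
    hP.mulVec_eigenvectorBasis, ?_, ?_⟩
  · simpa using hP.roots_charpoly_eq_eigenvalues
  · intro i j
    have := orthonormal_iff_ite.1 hP.eigenvectorBasis.orthonormal i j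
    rw [← this, EuclideanSpace.inner_eq_star_dotProduct, dotProduct_comm]
    simp
  · intro f g
    have := hP.eigenvectorBasis.sum_inner_mul_inner (WithLp.toLp 2 f) (WithLp.toLp 2 g)
    simp only [EuclideanSpace.inner_eq_star_dotProduct] at this
    simp only [star_trivial] at this
    rw [dotProduct_comm, ← this]
    exact Finset.sum_congr rfl fun i _ => by rw [dotProduct_comm g]

/-- Expansion in an orthonormal eigenbasis. The eigenvalue 1 may be multiple, so the basis need not
contain a constant vector. -/
lemma spectralGap_variational {P : Matrix V V ℝ} (hV : 2 ≤ Fintype.card V)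
    (hnn : ∀ u v, 0 ≤ P u v) (hsymm : ∀ u v, P u v = P v u) (hrow : ∀ u, ∑ v, P u v = 1) :
    (∀ f : V → ℝ, ∑ v, f v = 0 → spectralGap P * ∑ v, f v ^ 2 ≤ dirichletForm P f) ∧
    ∃ f : V → ℝ, f ≠ 0 ∧ ∑ v, f v = 0 ∧ dirichletForm P f ≤ spectralGap P * ∑ v, f v ^ 2 := by
  obtain ⟨μ, b, hroots, heig, horth, hpars⟩ := exists_orthonormal_eigenvectors hsymm
  have hsq : ∀ f : V → ℝ, ∑ v, f v ^ 2 = f ⬝ᵥ f := fun f => by simp [dotProduct, sq]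
  have hcoef : ∀ i (f : V → ℝ), b i ⬝ᵥ (P *ᵥ f) = μ i * (b i ⬝ᵥ f) := by
    intro i f
    have hT : Pᵀ = P := by ext u v; exact hsymm v u
    rw [dotProduct_mulVec, ← mulVec_transpose, hT, heig, smul_dotProduct, smul_eq_mul]
  have hone : P *ᵥ 1 = 1 := by ext u; simp [mulVec, dotProduct, hrow]
  have hone' : ∀ i, μ i ≠ 1 → b i ⬝ᵥ 1 = 0 := by
    intro i hi
    have := hcoef i 1
    rw [hone] at this
    have h : (μ i - 1) * (b i ⬝ᵥ 1) = 0 := by linarith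
    exact (mul_eq_zero.1 h).resolve_left (sub_ne_zero.2 hi)
  have hforms : ∀ f : V → ℝ, dirichletForm P f = ∑ i, (1 - μ i) * (b i ⬝ᵥ f) ^ 2 := by
    intro f
    rw [dirichletForm_eq hsymm hrow, hpars f f, hpars f (P *ᵥ f), ← Finset.sum_sub_distrib]
    exact Finset.sum_congr rfl fun i _ => by rw [hcoef]; ring
  have hle : ∀ i, μ i ≤ 1 := by
    intro i
    have := dirichletForm_nonneg hnn (b i)
    rw [hforms] at this
    simpa [horth] using this
  obtain ⟨i₀, hi₀⟩ : ∃ i, μ i = 1 := by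
    by_contra! hcon
    have := hpars 1 1
    rw [Finset.sum_eq_zero fun i _ => by rw [hone' i (hcon i), zero_mul]] at this
    simp [dotProduct] at this
    omega
  have hne : (Finset.univ.erase i₀).Nonempty := by
    rw [← Finset.card_pos, Finset.card_erase_of_mem (Finset.mem_univ _), Finset.card_univ]
    omega
  obtain ⟨i₁, hi₁, hmax⟩ := Finset.exists_max_image _ μ hne
  have hi₁₀ : i₁ ≠ i₀ := Finset.ne_of_mem_erase hi₁
  have hgap : spectralGap P = 1 - μ i₁ := by
    unfold spectralGap
    congr 1
    have herase : P.charpoly.roots.erase 1 = (Finset.univ.erase i₀).val.map μ := by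
      rw [hroots, ← Finset.insert_erase (Finset.mem_univ i₀),
        Finset.insert_val_of_notMem (Finset.notMem_erase _ _), Multiset.map_cons, hi₀,
        Multiset.erase_cons_head, Finset.insert_erase (Finset.mem_univ i₀)]
    rw [herase]
    refine IsGreatest.csSup_eq ⟨Multiset.mem_map_of_mem _ hi₁, ?_⟩
    rintro x hx
    obtain ⟨i, hi, rfl⟩ := Multiset.mem_map.1 hx
    exact hmax i hi
  rw [hgap]
  constructor
  · intro f hf
    rcases eq_or_lt_of_le (hle i₁) with h1 | h1
    · rw [h1, sub_self, zero_mul]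
      exact dirichletForm_nonneg hnn f
    have hlt : ∀ i, i ≠ i₀ → μ i < 1 := fun i hi =>
      (hmax i (Finset.mem_erase.2 ⟨hi, Finset.mem_univ i⟩)).trans_lt h1
    -- Here 1 is a simple eigenvalue, so the constant vector is a multiple of `b i₀`.
    have hf0 : b i₀ ⬝ᵥ f = 0 := by
      have hsingle : ∀ g : V → ℝ, (1 : V → ℝ) ⬝ᵥ g = (b i₀ ⬝ᵥ 1) * (b i₀ ⬝ᵥ g) := by
        intro g
        rw [hpars]
        exact Finset.sum_eq_single i₀
          (fun i _ hi => by rw [hone' i (hlt i hi).ne, zero_mul]) (by simp)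
      have h2 := hsingle f
      have h3 := hsingle 1
      have h4 : b i₀ ⬝ᵥ 1 ≠ 0 := by
        intro h
        rw [h, zero_mul] at h3
        simp [dotProduct] at h3
        omega
      have h5 : (1 : V → ℝ) ⬝ᵥ f = 0 := by simpa [dotProduct] using hf
      rw [h5] at h2
      exact (mul_eq_zero.1 h2.symm).resolve_left h4
    rw [hsq, hpars, hforms, Finset.mul_sum]
    refine Finset.sum_le_sum fun i _ => ?_
    by_cases hi : i = i₀
    · rw [hi, hf0]; simp
    · have := hmax i (Finset.mem_erase.2 ⟨hi, Finset.mem_univ i⟩)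
      nlinarith [sq_nonneg (b i ⬝ᵥ f)]
  · set α := b i₁ ⬝ᵥ 1 with hα
    set β := b i₀ ⬝ᵥ 1 with hβ
    have hcomb : ∀ x y : ℝ, ∀ i, b i ⬝ᵥ (x • b i₀ + y • b i₁) =
        x * (if i = i₀ then 1 else 0) + y * (if i = i₁ then 1 else 0) := by
      intro x y i
      rw [dotProduct_add, dotProduct_smul, dotProduct_smul, horth, horth, smul_eq_mul, smul_eq_mul]
    -- The span of `b i₀` and `b i₁` is two-dimensional, so it contains a nonzero vector of mean
    -- zero, whatever the multiplicity of 1.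
    have hxy : ∀ x y : ℝ, x * β + y * α = 0 → (x ≠ 0 ∨ y ≠ 0) →
        ∃ f : V → ℝ, f ≠ 0 ∧ ∑ v, f v = 0 ∧
          dirichletForm P f ≤ (1 - μ i₁) * ∑ v, f v ^ 2 := by
      intro x y h0 hor
      refine ⟨x • b i₀ + y • b i₁, ?_, ?_, ?_⟩
      · intro h
        have e0 := hcomb x y i₀
        have e1 := hcomb x y i₁
        rw [h, dotProduct_zero] at e0 e1
        simp only [hi₁₀, hi₁₀.symm, if_true, if_false] at e0 e1
        rcases hor with h | h
        · exact h (by linarith)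
        · exact h (by linarith)
      · have : (x • b i₀ + y • b i₁) ⬝ᵥ 1 = 0 := by
          rw [add_dotProduct, smul_dotProduct, smul_dotProduct]
          exact h0
        simpa [dotProduct] using this
      · rw [hsq, hpars, hforms, Finset.mul_sum]
        refine Finset.sum_le_sum fun i _ => ?_
        by_cases hi : i = i₀
        · subst hi
          nlinarith [sq_nonneg (b i ⬝ᵥ (x • b i + y • b i₁)), hle i₁]
        · by_cases hi' : i = i₁
          · rw [hi']; nlinarith
          · rw [hcomb]; simp [hi, hi']
    by_cases hα0 : α = 0
    · exact hxy 0 1 (by rw [hα0]; ring) (Or.inr one_ne_zero)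
    · exact hxy α (-β) (by ring) (Or.inl hα0)

omit [DecidableEq V] in
lemma IsLazyReversibleOn.symm_of_uniform [Nonempty V] {G : SimpleGraph V} {P : Matrix V V ℝ}
    (hP : IsLazyReversibleOn G (uniformDist V) P) (u v : V) : P u v = P v u := by
  have h := hP.reversible u v
  have hn : (1 / (Fintype.card V : ℝ)) ≠ 0 := by
    have : (Fintype.card V : ℝ) ≠ 0 := by exact_mod_cast Fintype.card_ne_zero
    positivity
  exact mul_left_cancel₀ hn h

lemma spectralGap_le_of_feasible {G : SimpleGraph V} (hV : 2 ≤ Fintype.card V)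
    {P : Matrix V V ℝ} (hP : IsLazyReversibleOn G (uniformDist V) P) {f g : V → ℝ}
    (hf : f ≠ 0) (hg : ∀ v, 0 ≤ g v) (hs : ∑ v, f v = 0)
    (he : ∀ v w, G.Adj v w → (f v - f w) ^ 2 ≤ g v + g w) :
    spectralGap P ≤ 1 / 2 * ((∑ v, g v) / ∑ v, f v ^ 2) := by
  have : Nonempty V := Fintype.card_pos_iff.1 (by omega)
  have hsymm := hP.symm_of_uniform
  have h1 := (spectralGap_variational hV hP.nonneg hsymm hP.row_sum).1 f hs
  rw [← mul_div_assoc, le_div_iff₀ (sum_sq_pos hf)]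
  refine h1.trans ?_
  -- Diagonal terms vanish on the left. Subtracting them on the right removes at least half of `2 *
  -- ∑ g`, by laziness.
  have hterm : ∀ u v, P u v * (f u - f v) ^ 2 ≤
      (P u v * g u + P u v * g v) - if u = v then 2 * (P u u * g u) else 0 := by
    intro u v
    split_ifs with huv
    · subst huv; simp; linarith
    · rw [sub_zero, ← mul_add]
      rcases (hP.nonneg u v).eq_or_lt with h | h
      · simp [← h]
      · exact mul_le_mul_of_nonneg_left (he u v ((hP.on_graph u v h).resolve_right huv)) h.le
  have h2 : ∑ u, ∑ v, P u v * g u = ∑ u, g u := by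
    simp only [← Finset.sum_mul, hP.row_sum, one_mul]
  have h3 : ∑ u, ∑ v, P u v * g v = ∑ u, g u := by
    rw [Finset.sum_comm, ← h2]
    exact Finset.sum_congr rfl fun u _ => Finset.sum_congr rfl fun v _ => by rw [hsymm]
  have h4 : ∑ u, g u ≤ ∑ u, 2 * (P u u * g u) :=
    Finset.sum_le_sum fun u _ => by nlinarith [hP.lazy u, hg u]
  have h5 := Finset.sum_le_sum fun u (_ : u ∈ Finset.univ) =>
    Finset.sum_le_sum fun v (_ : v ∈ Finset.univ) => hterm u v
  simp only [Finset.sum_add_distrib, Finset.sum_sub_distrib, h2, h3, Finset.sum_ite_eq,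
    Finset.mem_univ, if_true] at h5
  unfold dirichletForm
  linarith

lemma spectralGap_le_oneDimGap {G : SimpleGraph V} (hV : 2 ≤ Fintype.card V)
    {P : Matrix V V ℝ} (hP : IsLazyReversibleOn G (uniformDist V) P) :
    spectralGap P ≤ 1 / 2 * oneDimGap G := by
  have : 2 * spectralGap P ≤ oneDimGap G := by
    obtain ⟨f₀, g₀, hf₀, hg₀, hs₀, he₀⟩ := exists_oneDim_pair G hV
    refine le_csInf ⟨_, f₀, g₀, hf₀, hg₀, hs₀, he₀, rfl⟩ ?_
    rintro r ⟨f, g, hf, hg, hs, he, rfl⟩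
    linarith [spectralGap_le_of_feasible hV hP hf hg hs he]
  linarith

lemma optimalSpectralGap_le_oneDimGap (G : SimpleGraph V) (hV : 2 ≤ Fintype.card V) :
    optimalSpectralGap G (uniformDist V) ≤ 1 / 2 * oneDimGap G := by
  refine csSup_le ⟨_, 1, ?_, rfl⟩ ?_
  · constructor
    · intro v w; rw [one_apply]; split_ifs <;> norm_num
    · intro v; simp [one_apply]
    · intro v w h
      right
      by_contra hvw
      simp [one_apply_ne hvw] at h
    · intro v; norm_num
    · intro v w
      by_cases hvw : v = w
      · rw [hvw]
      · rw [one_apply_ne hvw, one_apply_ne (Ne.symm hvw)]; simp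
  · rintro γ ⟨P, hP, rfl⟩
    exact spectralGap_le_oneDimGap hV hP

lemma spectralGap_le_optimalSpectralGap {G : SimpleGraph V} (hV : 2 ≤ Fintype.card V)
    {P : Matrix V V ℝ} (hP : IsLazyReversibleOn G (uniformDist V) P) :
    spectralGap P ≤ optimalSpectralGap G (uniformDist V) := by
  refine le_csSup ⟨1 / 2 * oneDimGap G, ?_⟩ ⟨P, hP, rfl⟩
  rintro γ ⟨P, hP, rfl⟩
  exact spectralGap_le_oneDimGap hV hP

end Spectral

/-! ### A minimax theorem by separation of convex sets -/

/-- A finite minimax theorem: if every convex combination of the coordinates takes a value at most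
`a` on `F`, then the convex hull of `F` contains a point all of whose coordinates are below
`b > a`. -/
lemma exists_mem_convexHull_forall_lt {I : Type*} [Fintype I] [Nonempty I] {F : Set (I → ℝ)}
    {a b : ℝ} (hab : a < b)
    (hF : ∀ w : I → ℝ, (∀ i, 0 ≤ w i) → ∑ i, w i = 1 → ∃ y ∈ F, ∑ i, w i * y i ≤ a) :
    ∃ y ∈ convexHull ℝ F, ∀ i, y i < b := by
  classical
  by_contra! hcon
  set O : Set (I → ℝ) := Set.pi Set.univ fun _ => Set.Iio b with hO
  have hdisj : Disjoint O (convexHull ℝ F) := by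
    rw [Set.disjoint_left]
    intro y hy hy'
    obtain ⟨i, hi⟩ := hcon y hy'
    exact absurd (hy i (Set.mem_univ i)) (not_lt.2 hi)
  obtain ⟨φ, c, hφ1, hφ2⟩ := geometric_hahn_banach_open
    (convex_pi fun _ _ => convex_Iio b) (isOpen_set_pi Set.finite_univ fun _ _ => isOpen_Iio)
    (convex_convexHull ℝ F) hdisj
  set w : I → ℝ := fun i => φ (Pi.single i 1) with hw
  have hφ : ∀ y : I → ℝ, φ y = ∑ i, w i * y i := by
    intro y
    conv_lhs => rw [pi_eq_sum_univ' y]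
    rw [map_sum]
    refine Finset.sum_congr rfl fun i _ => ?_
    rw [map_smul, smul_eq_mul, mul_comm]
  have hconst : φ (fun _ => a) < c := hφ1 _ fun i _ => hab
  rw [hφ] at hconst
  -- The orthant is unbounded below in each coordinate, so a negative weight would push φ up to `c`.
  have hw0 : ∀ i, 0 ≤ w i := by
    intro i
    by_contra! hi
    set r : ℝ := (c - ∑ j, w j * a) / (-w i) with hr
    have hr0 : 0 < r := div_pos (by linarith) (by linarith)
    have := hφ1 ((fun _ => a) - r • Pi.single i 1) fun j _ => by
      by_cases hj : j = i
      · subst hj; simp; linarith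
      · simp [hj, hab]
    rw [map_sub, map_smul, hφ, smul_eq_mul] at this
    have h2 : r * w i = -(c - ∑ j, w j * a) := by
      rw [hr, div_mul_eq_mul_div, div_neg, mul_div_assoc, div_self hi.ne, mul_one]
    have h3 : φ (Pi.single i 1) = w i := rfl
    rw [h3, h2] at this
    linarith
  have hsum : 0 < ∑ i, w i := by
    refine (Finset.sum_nonneg fun i _ => hw0 i).lt_of_ne fun h => ?_
    have hz : ∀ i, w i = 0 := fun i =>
      (Finset.sum_eq_zero_iff_of_nonneg fun i _ => hw0 i).1 h.symm i (Finset.mem_univ i)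
    obtain ⟨y, hy, -⟩ := hF (fun _ => 1 / Fintype.card I) (fun _ => by positivity) (by simp)
    have := hφ2 y (subset_convexHull ℝ F hy)
    rw [hφ] at this
    simp [hz] at this hconst
    linarith
  obtain ⟨y, hy, hya⟩ := hF (fun i => w i / ∑ j, w j) (fun i => div_nonneg (hw0 i) hsum.le)
    (by rw [← Finset.sum_div, div_self hsum.ne'])
  have h1 := hφ2 y (subset_convexHull ℝ F hy)
  rw [hφ] at h1
  simp only [div_mul_eq_mul_div, ← Finset.sum_div] at hya
  rw [div_le_iff₀ hsum] at hya
  rw [← Finset.sum_mul] at hconst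
  linarith

/-! ### Moments and tails of random signed sums -/

section Rademacher

/-- The signed sum `∑ ± a i`. -/
noncomputable def signedSum {ι : Type*} [Fintype ι] (ε : ι → Bool) (a : ι → ℝ) : ℝ :=
  ∑ i, (if ε i then 1 else -1) * a i

variable {ι : Type*} [Fintype ι] [DecidableEq ι]

lemma sum_exp_signedSum_le (a : ι → ℝ) (t : ℝ) :
    ∑ ε : ι → Bool, Real.exp (t * signedSum ε a) ≤
      2 ^ Fintype.card ι * Real.exp (t ^ 2 / 2 * ∑ i, a i ^ 2) := by
  have h1 : ∀ ε : ι → Bool, Real.exp (t * signedSum ε a) =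
      ∏ i, Real.exp (t * ((if ε i then 1 else -1) * a i)) := by
    intro ε
    rw [signedSum, Finset.mul_sum, Real.exp_sum]
  have h2 : ∑ ε : ι → Bool, Real.exp (t * signedSum ε a) =
      ∏ i, ∑ s : Bool, Real.exp (t * ((if s then 1 else -1) * a i)) := by
    rw [Finset.prod_univ_sum, Fintype.piFinset_univ]
    exact Finset.sum_congr rfl fun ε _ => h1 ε
  have h3 : ∀ i, ∑ s : Bool, Real.exp (t * ((if s then 1 else -1) * a i)) ≤
      2 * Real.exp (t ^ 2 / 2 * a i ^ 2) := by
    intro i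
    have := Real.cosh_le_exp_half_sq (t * a i)
    rw [Real.cosh_eq] at this
    rw [Fintype.sum_bool]
    calc _ = 2 * ((Real.exp (t * a i) + Real.exp (-(t * a i))) / 2) := by
          simp; ring
      _ ≤ 2 * Real.exp ((t * a i) ^ 2 / 2) := by gcongr
      _ = _ := by ring_nf
  rw [h2]
  calc _ ≤ ∏ i : ι, 2 * Real.exp (t ^ 2 / 2 * a i ^ 2) :=
        Finset.prod_le_prod (fun i _ => Finset.sum_nonneg fun s _ => (Real.exp_pos _).le)
          fun i _ => h3 i
    _ = _ := by
        rw [Finset.prod_mul_distrib, Finset.prod_const, Finset.card_univ, ← Real.exp_sum,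
          Finset.mul_sum]

lemma sum_sq_signedSum (a : ι → ℝ) :
    ∑ ε : ι → Bool, signedSum ε a ^ 2 = 2 ^ Fintype.card ι * ∑ i, a i ^ 2 := by
  set s : Bool → ℝ := fun b => if b then 1 else -1 with hs
  have hss : ∀ b, s b * s b = 1 := by intro b; cases b <;> simp [hs]
  have hflip : ∀ b, s (!b) = -s b := by intro b; cases b <;> simp [hs]
  have hcross : ∀ i j, i ≠ j → ∑ ε : ι → Bool, s (ε i) * s (ε j) = 0 := by
    intro i j hij
    refine Finset.sum_involution (fun ε _ => Function.update ε i (!ε i)) ?_ ?_ ?_ ?_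
    · intro ε _
      simp [hflip, hij.symm]
    · intro ε _ _ h
      have := congrFun h i
      simp at this
    · simp
    · intro ε _
      simp
  have hexp : ∀ ε : ι → Bool, signedSum ε a ^ 2 =
      ∑ i, ∑ j, a i * a j * (s (ε i) * s (ε j)) := by
    intro ε
    rw [signedSum, sq, Finset.sum_mul_sum]
    exact Finset.sum_congr rfl fun i _ => Finset.sum_congr rfl fun j _ => by
      simp only [hs]; ring
  simp only [hexp]
  rw [Finset.sum_comm, Finset.mul_sum]
  refine Finset.sum_congr rfl fun i _ => ?_
  rw [Finset.sum_comm, Finset.sum_eq_single i]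
  · simp [hss, sq]
  · intro j _ hji
    rw [← Finset.mul_sum, hcross i j hji.symm, mul_zero]
  · simp

lemma sq_tail_le {t s z : ℝ} (ht : 0 ≤ t) :
    (if s < |z| then z ^ 2 else 0) ≤
      2 * Real.exp (-(t * s)) * (Real.exp ((t + 1) * z) + Real.exp (-(t + 1) * z)) := by
  split_ifs with h
  · have h1 : z ^ 2 / 2 ≤ Real.exp |z| := by
      have := Real.quadratic_le_exp_of_nonneg (abs_nonneg z)
      rw [sq_abs] at this
      linarith [abs_nonneg z]
    have h2 : Real.exp |z| ≤ Real.exp (-(t * s)) * Real.exp ((t + 1) * |z|) := by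
      rw [← Real.exp_add]
      exact Real.exp_le_exp.2 (by nlinarith)
    have h3 : Real.exp ((t + 1) * |z|) ≤
        Real.exp ((t + 1) * z) + Real.exp (-(t + 1) * z) := by
      rcases abs_cases z with ⟨h, -⟩ | ⟨h, -⟩ <;> rw [h]
      · linarith [Real.exp_pos (-(t + 1) * z)]
      · rw [mul_neg, neg_mul]
        linarith [Real.exp_pos ((t + 1) * z)]
    have h4 := mul_le_mul_of_nonneg_left h3 (Real.exp_pos (-(t * s))).le
    linarith
  · positivity

/-- Chernoff with parameter `t + 1`, the extra 1 paying for the square: the exponent `-4t² +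
(t+1)²/2` is at most `-2t²` once `t ≥ 1`. -/
lemma sum_sq_tail_signedSum_le {a : ι → ℝ} (ha : ∑ i, a i ^ 2 = 1) {t : ℝ} (ht : 1 ≤ t) :
    ∑ ε : ι → Bool, (if 4 * t < |signedSum ε a| then signedSum ε a ^ 2 else 0) ≤
      2 ^ Fintype.card ι * (4 * Real.exp (-(2 * t ^ 2))) := by
  refine (Finset.sum_le_sum fun ε _ =>
    sq_tail_le (t := t) (s := 4 * t) (z := signedSum ε a) (by linarith)).trans ?_
  rw [← Finset.mul_sum, Finset.sum_add_distrib]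
  have h1 := sum_exp_signedSum_le a (t + 1)
  have h2 := sum_exp_signedSum_le a (-(t + 1))
  rw [ha, mul_one] at h1 h2
  rw [neg_sq] at h2
  have h3 : Real.exp (-(t * (4 * t))) * Real.exp ((t + 1) ^ 2 / 2) ≤ Real.exp (-(2 * t ^ 2)) := by
    rw [← Real.exp_add]
    exact Real.exp_le_exp.2 (by nlinarith)
  calc _ ≤ 2 * Real.exp (-(t * (4 * t))) * (2 ^ Fintype.card ι * Real.exp ((t + 1) ^ 2 / 2) +
        2 ^ Fintype.card ι * Real.exp ((t + 1) ^ 2 / 2)) := by gcongr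
    _ = 2 ^ Fintype.card ι * (4 * (Real.exp (-(t * (4 * t))) * Real.exp ((t + 1) ^ 2 / 2))) := by
        ring
    _ ≤ _ := by gcongr

end Rademacher

/-! ### Projecting a vector embedding to the line -/

section Projection

variable {V : Type u} [Fintype V]

lemma sum_sum_sub_sq {x : V → ℝ} (hx : ∑ v, x v = 0) :
    ∑ u, ∑ v, (x u - x v) ^ 2 = 2 * Fintype.card V * ∑ v, x v ^ 2 := by
  have : ∀ u v, (x u - x v) ^ 2 = x u ^ 2 + x v ^ 2 - 2 * x u * x v := fun u v => by ring
  simp only [this, Finset.sum_sub_distrib, Finset.sum_add_distrib, ← Finset.mul_sum, hx,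
    Finset.sum_const, Finset.card_univ, nsmul_eq_mul]
  simp
  ring

/-- Projection of a vector embedding of `V` to the line, at a logarithmic loss. -/
lemma exists_signs_projection {ι : Type*} [Fintype ι] (hV : 2 ≤ Fintype.card V)
    (X : ι → V → ℝ) (hX0 : ∀ i, ∑ v, X i v = 0) (hX1 : ∑ i, ∑ v, X i v ^ 2 = 1) :
    ∃ x : V → ℝ, ∑ v, x v = 0 ∧ 1 / 2 ≤ ∑ v, x v ^ 2 ∧ ∀ u v, (x u - x v) ^ 2 ≤
      48 * Real.log (Fintype.card V) * ∑ i, (X i u - X i v) ^ 2 := by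
  classical
  have hn : (2 : ℝ) ≤ Fintype.card V := by exact_mod_cast hV
  set n : ℝ := ((Fintype.card V : ℕ) : ℝ) with hndef
  -- The constant 48 is `16 * 3`, from `(4 * t) ^ 2`; each pair then has tail at most `4 / n ^ 6`,
  -- enough to sum over `n ^ 2` pairs.
  set t : ℝ := √(3 * Real.log n) with ht
  have hlog : Real.log 2 ≤ Real.log n := Real.log_le_log (by norm_num) hn
  have hlog2 := Real.log_two_gt_d9
  have ht2 : t ^ 2 = 3 * Real.log n := Real.sq_sqrt (by linarith)
  have ht1 : 1 ≤ t := by rw [ht, Real.one_le_sqrt]; linarith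
  set D : V → V → ℝ := fun u v => ∑ i, (X i u - X i v) ^ 2 with hD
  have hD0 : ∀ u v, 0 ≤ D u v := fun u v => Finset.sum_nonneg fun i _ => sq_nonneg _
  have hDsum : ∑ u, ∑ v, D u v = 2 * n := by
    simp only [hD]
    have : ∀ u, ∑ v, ∑ i, (X i u - X i v) ^ 2 = ∑ i, ∑ v, (X i u - X i v) ^ 2 := fun u =>
      Finset.sum_comm
    simp only [this]
    rw [Finset.sum_comm]
    simp only [sum_sum_sub_sq (hX0 _), ← Finset.mul_sum, hX1, mul_one]
    rfl
  set x : (ι → Bool) → V → ℝ := fun ε v => signedSum ε fun i => X i v with hx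
  have hxsum : ∀ ε, ∑ v, x ε v = 0 := by
    intro ε
    simp only [hx, signedSum]
    rw [Finset.sum_comm]
    exact Finset.sum_eq_zero fun i _ => by rw [← Finset.mul_sum, hX0, mul_zero]
  -- If `D u v = 0`, division by zero makes this vector 0, consistently with `hdiff`.
  set a : V → V → ι → ℝ := fun u v i => (X i u - X i v) / √(D u v) with ha
  have hdiff : ∀ ε u v, x ε u - x ε v = √(D u v) * signedSum ε (a u v) := by
    intro ε u v
    simp only [hx, signedSum, Finset.mul_sum, ← Finset.sum_sub_distrib]
    refine Finset.sum_congr rfl fun i _ => ?_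
    simp only [ha]
    rcases (hD0 u v).eq_or_lt with h | h
    · have : (X i u - X i v) ^ 2 = 0 :=
        (Finset.sum_eq_zero_iff_of_nonneg fun i _ => sq_nonneg _).1 h.symm i (Finset.mem_univ i)
      have : X i u - X i v = 0 := by simpa using this
      rw [← mul_sub, this]; simp
    · have : √(D u v) ≠ 0 := (Real.sqrt_pos.2 h).ne'
      field_simp
  have hdiff2 : ∀ ε u v, (x ε u - x ε v) ^ 2 = signedSum ε (a u v) ^ 2 * D u v := by
    intro ε u v
    rw [hdiff, mul_pow, Real.sq_sqrt (hD0 u v), mul_comm]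
  set T : (ι → Bool) → V → V → ℝ := fun ε u v =>
    if 4 * t < |signedSum ε (a u v)| then signedSum ε (a u v) ^ 2 else 0 with hT
  have hT0 : ∀ ε u v, 0 ≤ T ε u v := by
    intro ε u v; simp only [hT]; split_ifs <;> positivity
  have hTsum : ∀ u v, ∑ ε, T ε u v ≤ 2 ^ Fintype.card ι * (4 * Real.exp (-(2 * t ^ 2))) := by
    intro u v
    rcases (hD0 u v).eq_or_lt with h | h
    · have : ∀ ε, T ε u v = 0 := by
        intro ε
        simp [hT, ha, ← h, signedSum]
      simp only [this, Finset.sum_const_zero]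
      positivity
    · apply sum_sq_tail_signedSum_le _ ht1
      simp only [ha, div_pow, Real.sq_sqrt h.le, ← Finset.sum_div]
      exact div_self h.ne'
  by_contra! hcon
  -- If every choice of signs fails, a large `∑ x ^ 2` forces an overstretched pair. That sum is at
  -- most the largest stretch `M`, which is itself a tail term. Averaging over signs gives the
  -- contradiction `1 ≤ 1/2 + 1/4`.
  have hpoint : ∀ ε, ∑ v, x ε v ^ 2 ≤ 1 / 2 + ∑ u, ∑ v, T ε u v := by
    intro ε
    have hTs : 0 ≤ ∑ u, ∑ v, T ε u v :=
      Finset.sum_nonneg fun u _ => Finset.sum_nonneg fun v _ => hT0 ε u v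
    rcases lt_or_ge (∑ v, x ε v ^ 2) (1 / 2) with h | h
    · linarith
    obtain ⟨u₁, v₁, hbad⟩ := hcon (x ε) (hxsum ε) h
    rw [hdiff2] at hbad
    have hbad' : 48 * Real.log n < signedSum ε (a u₁ v₁) ^ 2 :=
      lt_of_mul_lt_mul_right hbad (hD0 u₁ v₁)
    have : Nonempty (V × V) := ⟨(u₁, v₁)⟩
    obtain ⟨⟨u₀, v₀⟩, hmax⟩ := Finite.exists_max fun p : V × V => signedSum ε (a p.1 p.2) ^ 2
    have hmax' : ∀ u v, signedSum ε (a u v) ^ 2 ≤ signedSum ε (a u₀ v₀) ^ 2 := fun u v =>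
      hmax (u, v)
    set M := signedSum ε (a u₀ v₀) ^ 2 with hM
    have hTM : T ε u₀ v₀ = M := by
      simp only [hT]
      rw [if_pos]
      rw [← abs_of_nonneg (show 0 ≤ 4 * t by linarith), ← sq_lt_sq, mul_pow, ht2]
      have := hmax' u₁ v₁
      linarith
    have hZ : 2 * n * ∑ v, x ε v ^ 2 ≤ 2 * n * M := by
      rw [← sum_sum_sub_sq (hxsum ε), ← hDsum, Finset.sum_mul]
      refine Finset.sum_le_sum fun u _ => ?_
      rw [Finset.sum_mul]
      refine Finset.sum_le_sum fun v _ => ?_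
      rw [hdiff2, mul_comm]
      exact mul_le_mul_of_nonneg_left (hmax' u v) (hD0 u v)
    have hZ' : ∑ v, x ε v ^ 2 ≤ M := le_of_mul_le_mul_left hZ (by linarith)
    have hle : T ε u₀ v₀ ≤ ∑ u, ∑ v, T ε u v :=
      (Finset.single_le_sum (f := fun v => T ε u₀ v) (fun v _ => hT0 ε u₀ v)
        (Finset.mem_univ v₀)).trans
      (Finset.single_le_sum (f := fun u => ∑ v, T ε u v)
        (fun u _ => Finset.sum_nonneg fun v _ => hT0 ε u v) (Finset.mem_univ u₀))
    linarith
  have hsum := Finset.sum_le_sum fun ε (_ : ε ∈ Finset.univ) => hpoint ε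
  have hleft : ∑ ε, ∑ v, x ε v ^ 2 = 2 ^ Fintype.card ι := by
    rw [Finset.sum_comm]
    simp only [hx, sum_sq_signedSum, ← Finset.mul_sum]
    rw [Finset.sum_comm, hX1, mul_one]
  have hright : ∑ ε, ∑ u, ∑ v, T ε u v ≤
      n * (n * (2 ^ Fintype.card ι * (4 * Real.exp (-(2 * t ^ 2))))) := by
    rw [Finset.sum_comm]
    calc _ ≤ ∑ _u : V, ∑ _v : V, 2 ^ Fintype.card ι * (4 * Real.exp (-(2 * t ^ 2))) := by
          refine Finset.sum_le_sum fun u _ => ?_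
          rw [Finset.sum_comm]
          exact Finset.sum_le_sum fun v _ => hTsum u v
      _ = _ := by simp [hndef]
  have hexp : Real.exp (-(2 * t ^ 2)) = (n ^ 6)⁻¹ := by
    rw [ht2, Real.exp_neg, show 2 * (3 * Real.log n) = ((6 : ℕ) : ℝ) * Real.log n by norm_num; ring,
      Real.exp_nat_mul, Real.exp_log (by linarith)]
  rw [Finset.sum_add_distrib, hleft] at hsum
  simp only [Finset.sum_const, Finset.card_univ, Fintype.card_pi, Fintype.card_bool,
    Finset.prod_const, nsmul_eq_mul] at hsum
  push_cast at hsum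
  have hpow : (0 : ℝ) < 2 ^ Fintype.card ι := by positivity
  have hsmall : n * (n * (2 ^ Fintype.card ι * (4 * Real.exp (-(2 * t ^ 2))))) ≤
      2 ^ Fintype.card ι * (1 / 4) := by
    rw [hexp]
    have h16 : (2 : ℝ) ^ 4 ≤ n ^ 4 := pow_le_pow_left₀ (by norm_num) hn 4
    have hn0 : 0 < n := by linarith
    calc _ = 2 ^ Fintype.card ι * (4 / n ^ 4) := by field_simp
      _ ≤ _ := by
        refine mul_le_mul_of_nonneg_left ?_ hpow.le
        rw [div_le_iff₀ (by positivity)]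
        linarith
  linarith

end Projection

/-! ### Matchings as chains, duality and the logarithmic bound -/

section Matching

variable {V : Type u} [Fintype V] [DecidableEq V]

/-- A matching of `G`, encoded as the involution that swaps the endpoints of its edges. -/
def IsMatchingInvolution (G : SimpleGraph V) (σ : Equiv.Perm V) : Prop :=
  (∀ v, σ (σ v) = v) ∧ ∀ v, σ v ≠ v → G.Adj v (σ v)

omit [Fintype V] in
-- Greedy choice: match the longest edge inside `A`, delete its endpoints and recurse. Every edge
-- meeting those endpoints is no longer than the chosen one.
lemma exists_dominating_matching_on (G : SimpleGraph V) (d : V → V → ℝ)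
    (hsymm : ∀ u v, d u v = d v u) (hd : ∀ u v, 0 ≤ d u v) (A : Finset V) :
    ∃ σ : Equiv.Perm V, IsMatchingInvolution G σ ∧ (∀ v, v ∉ A → σ v = v) ∧
      ∀ u ∈ A, ∀ v ∈ A, G.Adj u v → d u v ≤ d u (σ u) + d v (σ v) := by
  classical
  induction A using Finset.strongInduction with | _ A ih =>
  set B := (A ×ˢ A).filter fun p => G.Adj p.1 p.2 with hB
  rcases B.eq_empty_or_nonempty with hE | hE
  · refine ⟨1, ⟨fun v => rfl, fun v h => (h rfl).elim⟩, fun v _ => rfl, fun u hu v hv huv => ?_⟩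
    have : (u, v) ∈ B := by simp [hB, hu, hv, huv]
    rw [hE] at this
    simp at this
  obtain ⟨⟨a, b⟩, habB, hmax⟩ := B.exists_max_image (fun p => d p.1 p.2) hE
  have hab' : (a ∈ A ∧ b ∈ A) ∧ G.Adj a b := by simpa [hB] using habB
  obtain ⟨⟨haA, hbA⟩, hab⟩ := hab'
  have hmax' : ∀ u ∈ A, ∀ v ∈ A, G.Adj u v → d u v ≤ d a b := fun u hu v hv huv =>
    hmax (u, v) (by simp [hB, hu, hv, huv])
  obtain ⟨σ, ⟨hinv, hadj⟩, hfix, hdom⟩ := ih (A \ {a, b})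
    (Finset.sdiff_ssubset (by simp [Finset.insert_subset_iff, haA, hbA]) (by simp))
  have hσa : σ a = a := hfix a (by simp)
  have hσb : σ b = b := hfix b (by simp)
  set τ : Equiv.Perm V := σ * Equiv.swap a b with hτ
  have hτa : τ a = b := by simp [hτ, hσb]
  have hτb : τ b = a := by simp [hτ, hσa]
  have hτo : ∀ v, v ≠ a → v ≠ b → τ v = σ v := fun v h1 h2 => by
    simp [hτ, Equiv.swap_apply_of_ne_of_ne h1 h2]
  refine ⟨τ, ⟨?_, ?_⟩, ?_, ?_⟩
  · intro v
    by_cases h1 : v = a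
    · rw [h1, hτa, hτb]
    by_cases h2 : v = b
    · rw [h2, hτb, hτa]
    rw [hτo v h1 h2, hτo, hinv]
    · intro h; exact h1 (σ.injective (h.trans hσa.symm))
    · intro h; exact h2 (σ.injective (h.trans hσb.symm))
  · intro v hv
    by_cases h1 : v = a
    · rw [h1, hτa]; exact hab
    by_cases h2 : v = b
    · rw [h2, hτb]; exact hab.symm
    rw [hτo v h1 h2] at hv ⊢
    exact hadj v hv
  · intro v hv
    have h1 : v ≠ a := fun h => hv (h ▸ haA)
    have h2 : v ≠ b := fun h => hv (h ▸ hbA)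
    rw [hτo v h1 h2]
    exact hfix v fun h => hv (Finset.mem_sdiff.1 h).1
  · have hend : ∀ u, u = a ∨ u = b → d u (τ u) = d a b := by
      rintro u (rfl | rfl)
      · rw [hτa]
      · rw [hτb, hsymm]
    intro u hu v hv huv
    by_cases h1 : u = a ∨ u = b
    · rw [hend u h1]
      linarith [hmax' u hu v hv huv, hd v (τ v)]
    by_cases h2 : v = a ∨ v = b
    · rw [hend v h2]
      linarith [hmax' u hu v hv huv, hd u (τ u)]
    rw [not_or] at h1 h2
    rw [hτo u h1.1 h1.2, hτo v h2.1 h2.2]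
    exact hdom u (by simp [hu, h1]) v (by simp [hv, h2]) huv

lemma exists_dominating_matching (G : SimpleGraph V) (d : V → V → ℝ)
    (hsymm : ∀ u v, d u v = d v u) (hd : ∀ u v, 0 ≤ d u v) :
    ∃ σ : Equiv.Perm V, IsMatchingInvolution G σ ∧
      ∀ u v, G.Adj u v → d u v ≤ d u (σ u) + d v (σ v) := by
  obtain ⟨σ, h1, -, h2⟩ := exists_dominating_matching_on G d hsymm hd Finset.univ
  exact ⟨σ, h1, fun u v => h2 u (Finset.mem_univ u) v (Finset.mem_univ v)⟩

/-- The lazy chain that moves along a random matching with weights `w`. -/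
noncomputable def matchingChain {I : Type*} [Fintype I] (σ : I → Equiv.Perm V) (w : I → ℝ) :
    Matrix V V ℝ :=
  fun u v => ∑ i, w i * ((if u = v then 1 / 2 else 0) + if σ i u = v then 1 / 2 else 0)

lemma isLazyReversibleOn_matchingChain {G : SimpleGraph V} {I : Type*} [Fintype I]
    {σ : I → Equiv.Perm V} (hσ : ∀ i, IsMatchingInvolution G (σ i)) {w : I → ℝ}
    (hw : ∀ i, 0 ≤ w i) (hw1 : ∑ i, w i = 1) :
    IsLazyReversibleOn G (uniformDist V) (matchingChain σ w) := by
  have hterm : ∀ i u v, 0 ≤ w i * ((if u = v then 1 / 2 else 0) +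
      if σ i u = v then (1 / 2 : ℝ) else 0) := fun i u v =>
    mul_nonneg (hw i) (by split_ifs <;> norm_num)
  constructor
  · exact fun u v => Finset.sum_nonneg fun i _ => hterm i u v
  · intro u
    simp only [matchingChain]
    rw [Finset.sum_comm]
    refine (Finset.sum_congr rfl fun i _ => ?_).trans hw1
    rw [← Finset.mul_sum, Finset.sum_add_distrib]
    simp
    norm_num
  · intro u v h
    obtain ⟨i, -, hi⟩ := Finset.exists_ne_zero_of_sum_ne_zero h.ne'
    by_cases huv : u = v
    · exact Or.inr huv
    by_cases hi' : σ i u = v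
    · left
      rw [← hi']
      exact (hσ i).2 u (by rw [hi']; exact Ne.symm huv)
    · simp [huv, hi'] at hi
  · intro u
    calc (1 / 2 : ℝ) = ∑ i, w i * (1 / 2) := by rw [← Finset.sum_mul, hw1, one_mul]
      _ ≤ _ := Finset.sum_le_sum fun i _ => mul_le_mul_of_nonneg_left
        (by simp only [if_true]; split_ifs <;> norm_num) (hw i)
  · intro u v
    simp only [uniformDist, matchingChain]
    congr 1
    refine Finset.sum_congr rfl fun i _ => ?_
    have h1 : (u = v) = (v = u) := propext eq_comm
    have h2 : (σ i u = v) = (σ i v = u) := propext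
      ⟨fun h => by rw [← h, (hσ i).1], fun h => by rw [← h, (hσ i).1]⟩
    simp only [h1, h2]

lemma dirichletForm_matchingChain {I : Type*} [Fintype I] (σ : I → Equiv.Perm V) (w : I → ℝ)
    (f : V → ℝ) :
    dirichletForm (matchingChain σ w) f = ∑ i, w i * (1 / 4 * ∑ u, (f u - f (σ i u)) ^ 2) := by
  have h1 : ∀ u, ∑ v, matchingChain σ w u v * (f u - f v) ^ 2 =
      ∑ i, w i * (1 / 2 * (f u - f (σ i u)) ^ 2) := by
    intro u
    simp only [matchingChain, Finset.sum_mul]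
    rw [Finset.sum_comm]
    refine Finset.sum_congr rfl fun i _ => ?_
    simp [mul_assoc, ← Finset.mul_sum, add_mul, Finset.sum_add_distrib, ite_mul]
  unfold dirichletForm
  simp only [h1]
  rw [Finset.sum_comm, Finset.mul_sum]
  refine Finset.sum_congr rfl fun i _ => ?_
  rw [← Finset.mul_sum, ← Finset.mul_sum]
  ring

/-- The dual description of the optimal spectral gap: a vector embedding that is nearly contracted
along every matching. -/
lemma exists_vector_embedding (G : SimpleGraph V) (hV : 2 ≤ Fintype.card V) {γ : ℝ}
    (hγ : optimalSpectralGap G (uniformDist V) < γ) :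
    ∃ (ι : Type) (_ : Fintype ι) (X : ι → V → ℝ), (∀ i, ∑ v, X i v = 0) ∧
      ∑ i, ∑ v, X i v ^ 2 = 1 ∧ ∀ σ : Equiv.Perm V, IsMatchingInvolution G σ →
        ∑ v, ∑ i, (X i v - X i (σ v)) ^ 2 ≤ 4 * γ := by
  classical
  have : Nonempty V := Fintype.card_pos_iff.1 (by omega)
  set I := {σ : Equiv.Perm V // IsMatchingInvolution G σ}
  have : Nonempty I := ⟨1, fun _ => rfl, fun _ h => (h rfl).elim⟩
  set F : Set (I → ℝ) := {y | ∃ f : V → ℝ, ∑ v, f v = 0 ∧ ∑ v, f v ^ 2 = 1 ∧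
    y = fun σ => 1 / 4 * ∑ u, (f u - f (σ.1 u)) ^ 2} with hF
  -- For any mixture of matchings, a variational minimiser of its chain has average energy at most
  -- λ*.
  obtain ⟨y, hy, hyγ⟩ := exists_mem_convexHull_forall_lt (F := F) hγ (by
    intro w hw hw1
    have hP := isLazyReversibleOn_matchingChain (G := G) (σ := fun σ : I => σ.1)
      (fun σ => σ.2) hw hw1
    obtain ⟨f, hf, hf0, hle⟩ :=
      (spectralGap_variational hV hP.nonneg hP.symm_of_uniform hP.row_sum).2
    have hN := sum_sq_pos hf
    set N := ∑ v, f v ^ 2 with hNdef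
    have hsN : √N ^ 2 = N := Real.sq_sqrt hN.le
    refine ⟨_, ⟨fun v => f v / √N, ?_, ?_, rfl⟩, ?_⟩
    · rw [← Finset.sum_div, hf0, zero_div]
    · simp only [div_pow, hsN, ← Finset.sum_div]
      exact div_self hN.ne'
    · have h1 : ∀ σ : I, 1 / 4 * ∑ u, (f u / √N - f (σ.1 u) / √N) ^ 2 =
          (1 / 4 * ∑ u, (f u - f (σ.1 u)) ^ 2) / N := by
        intro σ
        simp only [← sub_div, div_pow, hsN, ← Finset.sum_div]
        ring
      simp only [h1, ← mul_div_assoc, ← Finset.sum_div]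
      rw [div_le_iff₀ hN]
      rw [dirichletForm_matchingChain] at hle
      refine hle.trans ?_
      gcongr
      exact spectralGap_le_optimalSpectralGap hV hP)
  obtain ⟨ι, _, w, z, hw, hw1, hz, rfl⟩ := mem_convexHull_iff_exists_fintype.1 hy
  choose f hf0 hf1 hfz using hz
  have hsqrt : ∀ i, √(w i) ^ 2 = w i := fun i => Real.sq_sqrt (hw i)
  -- Scaling by `√(w i)` turns the convex combination of energies into the energy of one vector
  -- embedding.
  refine ⟨ι, inferInstance, fun i v => √(w i) * f i v, ?_, ?_, ?_⟩
  · intro i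
    rw [← Finset.mul_sum, hf0, mul_zero]
  · simp only [mul_pow, hsqrt, ← Finset.mul_sum, hf1, mul_one, hw1]
  · intro σ hσ
    have h := hyγ ⟨σ, hσ⟩
    rw [Finset.sum_apply] at h
    simp only [hfz, Pi.smul_apply, smul_eq_mul] at h
    simp only [← mul_sub, mul_pow, hsqrt]
    rw [Finset.sum_comm]
    simp only [← Finset.mul_sum]
    have h2 : ∑ i, w i * (1 / 4 * ∑ u, (f i u - f i (σ u)) ^ 2) =
        1 / 4 * ∑ i, w i * ∑ u, (f i u - f i (σ u)) ^ 2 := by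
      rw [Finset.mul_sum]
      exact Finset.sum_congr rfl fun i _ => by ring
    rw [h2] at h
    linarith

lemma oneDimGap_le_log_mul_optimalSpectralGap (G : SimpleGraph V) (hV : 2 ≤ Fintype.card V) :
    oneDimGap G ≤ 384 * Real.log (Fintype.card V) * optimalSpectralGap G (uniformDist V) := by
  have hlog : 0 < Real.log (Fintype.card V) := Real.log_pos (by exact_mod_cast hV)
  suffices h : oneDimGap G / (384 * Real.log (Fintype.card V)) ≤
      optimalSpectralGap G (uniformDist V) by
    rw [div_le_iff₀ (by positivity)] at h
    linarith
  refine le_of_forall_gt_imp_ge_of_dense fun γ hγ => ?_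
  obtain ⟨ι, _, X, hX0, hX1, hXσ⟩ := exists_vector_embedding G hV hγ
  obtain ⟨x, hx0, hx1, hx⟩ := exists_signs_projection hV X hX0 hX1
  obtain ⟨σ, hσ, hdom⟩ := exists_dominating_matching G (fun u v => ∑ i, (X i u - X i v) ^ 2)
    (fun u v => Finset.sum_congr rfl fun i _ => by ring)
    (fun u v => Finset.sum_nonneg fun i _ => sq_nonneg _)
  set L := Real.log (Fintype.card V)
  have hx2 : x ≠ 0 := by
    rintro rfl
    norm_num at hx1
  -- The constant 384 is `48 * 4 * 2`: projection loss, matching energy `4 * γ`, and `∑ x ^ 2 ≥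
  -- 1/2`.
  have hle := oneDimGap_le G (f := x) (g := fun u => 48 * L * ∑ i, (X i u - X i (σ u)) ^ 2) hx2
    (fun v => mul_nonneg (by positivity) (Finset.sum_nonneg fun i _ => sq_nonneg _)) hx0
    (fun u v huv => (hx u v).trans (by
      rw [← mul_add]
      exact mul_le_mul_of_nonneg_left (hdom u v huv) (by positivity)))
  rw [div_le_iff₀ (by positivity)]
  refine hle.trans ?_
  rw [← Finset.mul_sum, div_le_iff₀ (by linarith)]
  have h1 := hXσ σ hσ
  have h0 : 0 ≤ ∑ v, ∑ i, (X i v - X i (σ v)) ^ 2 :=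
    Finset.sum_nonneg fun v _ => Finset.sum_nonneg fun i _ => sq_nonneg _
  have hγ0 : 0 ≤ γ := by linarith
  calc _ ≤ 48 * L * (4 * γ) := by gcongr
    _ = γ * (384 * L) * (1 / 2) := by ring
    _ ≤ _ := by gcongr

end Matching

theorem mainTheorem2 :
    ∃ c C : ℝ, 0 < c ∧ 0 < C ∧
      ∀ (V : Type u) [Fintype V] [DecidableEq V] (G : SimpleGraph V), 2 ≤ Fintype.card V →
        (c * matchingConductance G ^ 2 ≤ oneDimGap G ∧
          oneDimGap G ≤ C * matchingConductance G) ∧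
        (c * (matchingConductance G ^ 2 / Real.log (Fintype.card V)) ≤
            optimalSpectralGap G (uniformDist V) ∧
          optimalSpectralGap G (uniformDist V) ≤ C * matchingConductance G) := by
  refine ⟨1 / (72 * 384), 4, by norm_num, by norm_num, ?_⟩
  intro V _ _ G hV
  have hlog : 0 < Real.log (Fintype.card V) := Real.log_pos (by exact_mod_cast hV)
  have h1 := oneDimGap_le_four_mul_matchingConductance G hV
  have h2 := matchingConductance_sq_le_mul_oneDimGap G hV
  have h3 := optimalSpectralGap_le_oneDimGap G hV
  have h4 := oneDimGap_le_log_mul_optimalSpectralGap G hV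
  have h5 := sq_nonneg (matchingConductance G)
  have h6 := matchingConductance_nonneg G
  refine ⟨⟨by linarith, h1⟩, ?_, by linarith⟩
  rw [← mul_div_assoc, div_le_iff₀ hlog]
  linarith
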